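/- Let $n\ge 2$, $J=\mathrm{diag}(1,\dots,1,-1)\in GL(n+1,\mathbb R)$ and $O(n,1)=\{A\in GL(n+1,\mathbb R): JA^TJ=A^{-1}\}$, a Lie group with Lie algebra $\mathfrak o(n,1)=\{X: JX^TJ=-X\}$, where $[X,Y]=XY-YX$. Let $B(X,Y)=\mathrm{tr}(\mathrm{ad}X\circ\mathrm{ad}Y)$ be the Killing form, $\theta(X)=-X^T$, let $g_0$ be the left-invariant Riemannian metric on $O(n,1)$ induced by $B_\theta(X,Y)=-B(X,\theta Y)$, and let $\tilde g_0=\frac1{2(n-1)}g_0$. Let $\nabla$ be the Levi-Civita connection of $\tilde g_0$, $R(X,Y)Z=\nabla_X\nabla_YZ-\nabla_Y\nabla_XZ-\nabla_{[X,Y]}Z$, and, with all inner products and norms taken with respect to $\tilde g_0$, $$K(X,Y)=\frac{\langle R(X,Y)Y,X\rangle}{\|X\|^2\|Y\|^2-\langle X,Y\rangle^2},$$ where elements of $\mathfrak o(n,1)$ are regarded as left-invariant vector fields. Let $e_{ij}$ be the matrix units and let the standard basis of $\mathfrak o(n,1)$ consist of $\alpha_{ij}=e_{ij}-e_{ji}$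 for $1\le i<j\le n$ and $\sigma_{k,n+1}=e_{k,n+1}+e_{n+1,k}$ for $1\le k\le n$. Then, at every point of $O(n,1)$, $K(X,Y)\le\frac14$ for any two distinct elements $X,Y$ of the standard basis, and $K(\sigma_{i,n+1},\sigma_{j,n+1})\le 0$ for all $i\ne j$. -/

import Mathlib

open scoped Manifold ContDiff Matrix Bundle
open LieAlgebra.Orthogonal

attribute [local instance 100] LieRing.ofAssociativeRing LieAlgebra.ofAssociativeAlgebra
attribute [local instance] Matrix.linftyOpNormedRing Matrix.linftyOpNormedAlgebra

namespace Lorentz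

/-- Real `(n+1) × (n+1)` matrices; the last row and column carry the index `Sum.inr 0`. -/
abbrev Mat (n : ℕ) : Type := Matrix (Fin n ⊕ Fin 1) (Fin n ⊕ Fin 1) ℝ

/-- The usual topology on matrices, as the topology of the norm. -/
noncomputable abbrev matTopology (n : ℕ) : TopologicalSpace (Mat n) :=
  PseudoMetricSpace.toUniformSpace.toTopologicalSpace

end Lorentz

attribute [local instance] Lorentz.matTopology

noncomputable section

namespace Lorentz

/-- `J = diag(1, …, 1, -1)`. -/
abbrev J (n : ℕ) : Mat n := indefiniteDiagonal (Fin n) (Fin 1) ℝ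

theorem J_mul_J (n : ℕ) : J n * J n = 1 := by
  rw [J, indefiniteDiagonal, Matrix.diagonal_mul_diagonal, ← Matrix.diagonal_one]
  congr 1
  ext i
  cases i <;> simp

theorem J_transpose (n : ℕ) : (J n)ᵀ = J n := Matrix.diagonal_transpose _

/-- The Lorentz group `O(n,1) = {A ∈ GL(n+1,ℝ) : J Aᵀ J = A⁻¹}`. -/
def O (n : ℕ) : Subgroup (Mat n)ˣ where
  carrier := {A | J n * (A : Mat n)ᵀ * J n = (A⁻¹ : (Mat n)ˣ)}
  mul_mem' := by
    intro A B hA hB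
    simp only [Set.mem_ofPred_eq] at hA hB ⊢
    rw [mul_inv_rev, Units.val_mul, Units.val_mul, ← hA, ← hB, Matrix.transpose_mul]
    simp only [mul_assoc]
    rw [← mul_assoc (J n) (J n), J_mul_J, one_mul]
  one_mem' := by simp [J_mul_J]
  inv_mem' := by
    intro A hA
    simp only [Set.mem_ofPred_eq] at hA ⊢
    rw [← hA, inv_inv, Matrix.transpose_mul, Matrix.transpose_mul, J_transpose,
      Matrix.transpose_transpose]
    simp only [mul_assoc]
    rw [J_mul_J, mul_one, ← mul_assoc, J_mul_J, one_mul]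

/-- The inclusion of `O(n,1)` into the space of matrices. -/
def incl (n : ℕ) (A : O n) : Mat n := ((A : (Mat n)ˣ) : Mat n)

/-- The Lie algebra `𝔬(n,1)`: matrices `X` with `J Xᵀ J = -X`, with the commutator as bracket. -/
abbrev 𝔬 (n : ℕ) : LieSubalgebra ℝ (Mat n) := so' (Fin n) (Fin 1) ℝ

theorem mem_𝔬 {n : ℕ} (X : Mat n) : X ∈ 𝔬 n ↔ J n * Xᵀ * J n = -X := by
  rw [𝔬, so', mem_skewAdjointMatricesLieSubalgebra, mem_skewAdjointMatricesSubmodule]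
  simp only [Matrix.IsSkewAdjoint, Matrix.IsAdjointPair]
  constructor
  · intro h
    rw [mul_assoc, h, ← mul_assoc, J_mul_J, one_mul]
  · intro h
    rw [← h, ← mul_assoc, ← mul_assoc, J_mul_J, one_mul]

/-- The underlying vector space of `𝔬(n,1)`, on which `O(n,1)` is modelled. -/
abbrev E (n : ℕ) : Type := ↥(𝔬 n).toSubmodule


theorem incl_mul {n : ℕ} (A B : O n) : incl n (A * B) = incl n A * incl n B := rfl

theorem incl_inv {n : ℕ} (A : O n) : incl n A⁻¹ = J n * (incl n A)ᵀ * J n := A.2.symm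

theorem incl_inv_mul {n : ℕ} (A : O n) : incl n A⁻¹ * incl n A = 1 := by
  rw [← incl_mul, inv_mul_cancel]; rfl

theorem incl_mul_inv {n : ℕ} (A : O n) : incl n A * incl n A⁻¹ = 1 := by
  rw [← incl_mul, mul_inv_cancel]; rfl

theorem continuous_incl (n : ℕ) : Continuous (incl n) :=
  Units.continuous_val.comp continuous_subtype_val

theorem isInducing_incl (n : ℕ) : Topology.IsInducing (incl n) := by
  refine (Units.isOpenEmbedding_val (R := Mat n)).isInducing.comp Topology.IsInducing.subtypeVal

theorem incl_injective (n : ℕ) : Function.Injective (incl n) :=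
  Units.val_injective.comp Subtype.val_injective


theorem J_conj_mul {n : ℕ} (A B : Mat n) :
    J n * (A * B)ᵀ * J n = (J n * Bᵀ * J n) * (J n * Aᵀ * J n) := by
  rw [Matrix.transpose_mul]
  simp only [mul_assoc]
  rw [← mul_assoc (J n) (J n), J_mul_J, one_mul]

theorem J_conj_inv {n : ℕ} (A : Mat n) : J n * (A⁻¹)ᵀ * J n = (J n * Aᵀ * J n)⁻¹ := by
  have hJ : (J n)⁻¹ = J n := Matrix.inv_eq_right_inv (J_mul_J n)
  rw [Matrix.mul_inv_rev, Matrix.mul_inv_rev, hJ, Matrix.transpose_nonsing_inv, mul_assoc]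

theorem det_J_conj {n : ℕ} (A : Mat n) : (J n * Aᵀ * J n).det = A.det := by
  rw [Matrix.det_mul, Matrix.det_mul, Matrix.det_transpose, mul_comm, ← mul_assoc,
    ← Matrix.det_mul, J_mul_J, Matrix.det_one, one_mul]

/-- Cayley transform `A ↦ 2 (A - 1) (A + 1)⁻¹`. -/
def cay {n : ℕ} (A : Mat n) : Mat n := (2 : ℝ) • ((A - 1) * (A + 1)⁻¹)

/-- Inverse Cayley transform `X ↦ (2 + X) (2 - X)⁻¹`. -/
def yac {n : ℕ} (X : Mat n) : Mat n := (2 + X) * (2 - X)⁻¹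

theorem cay_mem {n : ℕ} (A : O n) : cay (incl n A) ∈ 𝔬 n := by
  by_cases h : IsUnit (incl n A + 1).det
  · rw [mem_𝔬, cay]
    set a := incl n A
    have ha : J n * aᵀ * J n = incl n A⁻¹ := (incl_inv A).symm
    set b := incl n A⁻¹
    have hab : a * b = 1 := incl_mul_inv A
    have hba : b * a = 1 := incl_inv_mul A
    have h1 : J n * (a - 1)ᵀ * J n = b - 1 := by
      simp [mul_sub, sub_mul, ha, J_mul_J]
    have h2 : J n * (a + 1)ᵀ * J n = b + 1 := by
      simp [mul_add, add_mul, ha, J_mul_J]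
    have hb : IsUnit (b + 1).det := by rw [← h2, det_J_conj]; exact h
    rw [Matrix.transpose_smul, mul_smul_comm, smul_mul_assoc, J_conj_mul, J_conj_inv, h1, h2,
      ← smul_neg]
    congr 1
    have : (b - 1) * (a + 1) = -((b + 1) * (a - 1)) := by
      simp only [mul_add, add_mul, sub_mul, mul_sub, hba, mul_one, one_mul]
      abel
    calc (b + 1)⁻¹ * (b - 1) = (b + 1)⁻¹ * ((b - 1) * (a + 1)) * (a + 1)⁻¹ := by
          rw [mul_assoc, Matrix.mul_nonsing_inv_cancel_right _ _ h]
      _ = -((a - 1) * (a + 1)⁻¹) := by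
          rw [this, mul_neg, Matrix.nonsing_inv_mul_cancel_left _ _ hb, neg_mul]
  · rw [cay, Matrix.nonsing_inv_apply_not_isUnit _ h, mul_zero, smul_zero]
    exact zero_mem _

theorem yac_mul_aux {n : ℕ} {X : Mat n} (hX : X ∈ 𝔬 n) (h : IsUnit (2 - X).det) :
    (J n * (yac X)ᵀ * J n) * yac X = 1 := by
  rw [mem_𝔬] at hX
  have hJ2 : J n * (2 : Mat n)ᵀ * J n = 2 := by
    rw [show (2 : Mat n) = 1 + 1 by norm_num]
    simp [mul_add, add_mul, J_mul_J]
  have h1 : J n * (2 + X)ᵀ * J n = 2 - X := by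
    rw [Matrix.transpose_add, mul_add, add_mul, hX, hJ2, sub_eq_add_neg]
  have h2 : J n * (2 - X)ᵀ * J n = 2 + X := by
    rw [Matrix.transpose_sub, mul_sub, sub_mul, hX, hJ2, sub_neg_eq_add]
  have h' : IsUnit (2 + X).det := by rw [← h2, det_J_conj]; exact h
  have hc : (2 - X) * (2 + X) = (2 + X) * (2 - X) := by noncomm_ring
  rw [yac, J_conj_mul, J_conj_inv, h1, h2]
  calc (2 + X)⁻¹ * (2 - X) * ((2 + X) * (2 - X)⁻¹)
      = (2 + X)⁻¹ * ((2 - X) * (2 + X)) * (2 - X)⁻¹ := by simp only [mul_assoc]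
    _ = 1 := by
      rw [hc, Matrix.nonsing_inv_mul_cancel_left _ _ h', Matrix.mul_nonsing_inv _ h]

open Classical in
/-- The inverse Cayley transform with values in `O(n,1)` (and value `1` where `2 - X` is
singular). -/
def toO {n : ℕ} (X : E n) : O n :=
  if h : IsUnit (2 - X.1).det then
    ⟨⟨yac X.1, J n * (yac X.1)ᵀ * J n, mul_eq_one_comm.1 (yac_mul_aux X.2 h),
      yac_mul_aux X.2 h⟩, rfl⟩
  else 1

theorem incl_toO {n : ℕ} {X : E n} (h : IsUnit (2 - X.1).det) : incl n (toO X) = yac X.1 := by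
  rw [toO, dif_pos h]; rfl

theorem two_sub_cay {n : ℕ} {A : Mat n} (h : IsUnit (A + 1).det) :
    2 - cay A = (4 : ℝ) • (A + 1)⁻¹ := by
  have : (2 : Mat n) = (2 : ℝ) • ((A + 1) * (A + 1)⁻¹) := by
    rw [Matrix.mul_nonsing_inv _ h, Algebra.smul_def, mul_one]; rfl
  rw [cay, this, ← smul_sub, ← sub_mul]
  have h2 : A + 1 - (A - 1) = (2 : ℝ) • (1 : Mat n) := by
    rw [two_smul]; abel
  rw [h2, smul_mul_assoc, one_mul, smul_smul]; norm_num

theorem two_add_cay {n : ℕ} {A : Mat n} (h : IsUnit (A + 1).det) :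
    2 + cay A = (4 : ℝ) • (A * (A + 1)⁻¹) := by
  have : (2 : Mat n) = (2 : ℝ) • ((A + 1) * (A + 1)⁻¹) := by
    rw [Matrix.mul_nonsing_inv _ h, Algebra.smul_def, mul_one]; rfl
  rw [cay, this, ← smul_add, ← add_mul]
  have h2 : A + 1 + (A - 1) = (2 : ℝ) • A := by
    rw [two_smul]; abel
  rw [h2, smul_mul_assoc, smul_smul]; norm_num

theorem isUnit_two_sub_cay {n : ℕ} {A : Mat n} (h : IsUnit (A + 1).det) :
    IsUnit (2 - cay A).det := by
  rw [two_sub_cay h, Matrix.det_smul]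
  refine (IsUnit.mk0 _ (by positivity)).mul ?_
  exact Matrix.isUnit_nonsing_inv_det _ h

theorem yac_cay {n : ℕ} {A : Mat n} (h : IsUnit (A + 1).det) : yac (cay A) = A := by
  have h4 : IsUnit ((A + 1)⁻¹).det := Matrix.isUnit_nonsing_inv_det _ h
  refine ((Matrix.isUnit_iff_isUnit_det _).2 (isUnit_two_sub_cay h)).mul_right_cancel ?_
  rw [yac, Matrix.nonsing_inv_mul_cancel_right _ _ (isUnit_two_sub_cay h), two_add_cay h,
      two_sub_cay h, mul_smul_comm]

theorem yac_add_one {n : ℕ} {X : Mat n} (h : IsUnit (2 - X).det) :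
    yac X + 1 = (4 : ℝ) • (2 - X)⁻¹ := by
  have h1 : (1 : Mat n) = (2 - X) * (2 - X)⁻¹ := (Matrix.mul_nonsing_inv _ h).symm
  rw [yac]
  nth_rw 1 [h1]
  rw [← add_mul, show 2 + X + (2 - X) = (4 : ℝ) • (1 : Mat n) by
    rw [Algebra.smul_def, mul_one, show (algebraMap ℝ (Mat n)) 4 = 4 from rfl]; norm_num,
    smul_mul_assoc, one_mul]

theorem yac_sub_one {n : ℕ} {X : Mat n} (h : IsUnit (2 - X).det) :
    yac X - 1 = (2 : ℝ) • (X * (2 - X)⁻¹) := by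
  have h1 : (1 : Mat n) = (2 - X) * (2 - X)⁻¹ := (Matrix.mul_nonsing_inv _ h).symm
  rw [yac]
  nth_rw 1 [h1]
  rw [← sub_mul, show 2 + X - (2 - X) = (2 : ℝ) • X by rw [two_smul]; abel, smul_mul_assoc]

theorem isUnit_yac_add_one {n : ℕ} {X : Mat n} (h : IsUnit (2 - X).det) :
    IsUnit (yac X + 1).det := by
  rw [yac_add_one h, Matrix.det_smul]
  refine (IsUnit.mk0 _ (by positivity)).mul ?_
  exact Matrix.isUnit_nonsing_inv_det _ h

theorem cay_yac {n : ℕ} {X : Mat n} (h : IsUnit (2 - X).det) : cay (yac X) = X := by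
  have h3 := isUnit_yac_add_one h
  refine ((Matrix.isUnit_iff_isUnit_det _).2 h3).mul_right_cancel ?_
  rw [cay, smul_mul_assoc, Matrix.nonsing_inv_mul_cancel_right _ _ h3, yac_add_one h,
      yac_sub_one h, mul_smul_comm, smul_smul]
  norm_num

theorem contDiffAt_inv {n : ℕ} {A : Mat n} (h : IsUnit A.det) (m : ℕ∞ω) :
    ContDiffAt ℝ m (fun B : Mat n => B⁻¹) A := by
  have h' : IsUnit A := (Matrix.isUnit_iff_isUnit_det A).2 h
  obtain ⟨u, rfl⟩ := h'
  have := contDiffAt_ringInverse ℝ (n := m) u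
  refine this.congr_of_eventuallyEq (Filter.Eventually.of_forall fun B => ?_)
  exact Matrix.nonsing_inv_eq_ringInverse B

theorem contDiffAt_cay {n : ℕ} {A : Mat n} (h : IsUnit (A + 1).det) (m : ℕ∞ω) :
    ContDiffAt ℝ m (cay (n := n)) A := by
  have h1 : ContDiffAt ℝ m (fun B : Mat n => (B + 1)⁻¹) A :=
    ContDiffAt.comp (g := fun B : Mat n => B⁻¹) (f := fun B : Mat n => B + 1) A
      (contDiffAt_inv h m) (contDiffAt_id.add contDiffAt_const)
  exact ((contDiffAt_id.sub contDiffAt_const).mul h1).const_smul _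

theorem contDiffAt_yac {n : ℕ} {X : Mat n} (h : IsUnit (2 - X).det) (m : ℕ∞ω) :
    ContDiffAt ℝ m (yac (n := n)) X := by
  have h1 : ContDiffAt ℝ m (fun B : Mat n => (2 - B)⁻¹) X :=
    ContDiffAt.comp (g := fun B : Mat n => B⁻¹) (f := fun B : Mat n => 2 - B) X
      (contDiffAt_inv h m) (contDiffAt_const.sub contDiffAt_id)
  exact (contDiffAt_const.add contDiffAt_id).mul h1

theorem isOpen_isUnit_det (n : ℕ) : IsOpen {A : Mat n | IsUnit A.det} := by
  simp only [isUnit_iff_ne_zero]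
  exact isOpen_ne_fun (Continuous.matrix_det continuous_id) continuous_const

/-- The Cayley chart of `O(n,1)` at the identity. -/
def cayleyChart (n : ℕ) : OpenPartialHomeomorph (O n) (E n) where
  toFun A := ⟨cay (incl n A), cay_mem A⟩
  invFun := toO
  source := {A | IsUnit (incl n A + 1).det}
  target := {X | IsUnit (2 - X.1).det}
  map_source' A hA := isUnit_two_sub_cay hA
  map_target' X hX := by
    change IsUnit (incl n (toO X) + 1).det
    rw [incl_toO hX]
    exact isUnit_yac_add_one hX
  left_inv' A hA := by
    apply incl_injective
    rw [incl_toO (isUnit_two_sub_cay hA)]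
    exact yac_cay hA
  right_inv' X hX := by
    apply Subtype.ext
    change cay (incl n (toO X)) = X.1
    rw [incl_toO hX]
    exact cay_yac hX
  open_source := (isOpen_isUnit_det n).preimage ((continuous_incl n).add continuous_const)
  open_target := (isOpen_isUnit_det n).preimage (continuous_const.sub continuous_subtype_val)
  continuousOn_toFun := by
    rw [Topology.IsInducing.subtypeVal.continuousOn_iff]
    intro A hA
    exact ((contDiffAt_cay hA 0).continuousAt.comp
      (continuous_incl n).continuousAt).continuousWithinAt
  continuousOn_invFun := by
    rw [(isInducing_incl n).continuousOn_iff]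
    have : ContinuousOn (fun X : E n => yac X.1) {X | IsUnit (2 - X.1).det} := fun X hX =>
      ((contDiffAt_yac hX 0).continuousAt.comp continuousAt_subtype_val).continuousWithinAt
    exact this.congr fun X hX => incl_toO hX

theorem isUnit_det_one_add_one (n : ℕ) : IsUnit ((1 : Mat n) + 1).det := by
  rw [← two_smul ℝ (1 : Mat n), Matrix.det_smul, Matrix.det_one, mul_one]
  exact IsUnit.mk0 _ (by positivity)

/-- The chart `A ↦ cay (g⁻¹ A)` centred at `g`. -/
def chartO {n : ℕ} (g : O n) : OpenPartialHomeomorph (O n) (E n) :=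
  (Homeomorph.mulLeft g⁻¹).toOpenPartialHomeomorph.trans (cayleyChart n)

theorem chartO_apply {n : ℕ} (g A : O n) :
    (chartO g A : Mat n) = cay (incl n g⁻¹ * incl n A) := rfl

theorem mem_chartO_source {n : ℕ} (g A : O n) :
    A ∈ (chartO g).source ↔ IsUnit (incl n g⁻¹ * incl n A + 1).det := by
  rw [chartO, OpenPartialHomeomorph.trans_source]
  exact ⟨fun h => h.2, fun h => ⟨trivial, h⟩⟩

theorem mem_chartO_target {n : ℕ} (g : O n) (X : E n) :
    X ∈ (chartO g).target ↔ IsUnit (2 - X.1).det := by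
  rw [chartO, OpenPartialHomeomorph.trans_target]
  exact ⟨fun h => h.1, fun h => ⟨h, trivial⟩⟩

theorem incl_chartO_symm {n : ℕ} (g : O n) {X : E n} (h : X ∈ (chartO g).target) :
    incl n ((chartO g).symm X) = incl n g * yac X.1 := by
  have : (chartO g).symm X = (g⁻¹)⁻¹ * toO X := rfl
  rw [this, inv_inv, incl_mul, incl_toO ((mem_chartO_target g X).1 h)]

/-- Smooth structure on `O(n,1)`: left translates of the Cayley chart. -/
instance (n : ℕ) : ChartedSpace (E n) (O n) where
  atlas := Set.range chartO
  chartAt g := chartO g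
  mem_chart_source g := by
    rw [mem_chartO_source, incl_inv_mul]
    exact isUnit_det_one_add_one n
  chart_mem_atlas g := ⟨g, rfl⟩

/-- The model with corners of `O(n,1)`. -/
abbrev I (n : ℕ) : ModelWithCorners ℝ (E n) (E n) := 𝓘(ℝ, E n)

/-- The projection of matrices onto `𝔬(n,1)`. -/
def proj (n : ℕ) : Mat n →L[ℝ] E n :=
  LinearMap.toContinuousLinearMap
    { toFun := fun A => ⟨(1 / 2 : ℝ) • (A - J n * Aᵀ * J n), by
        refine (mem_𝔬 _).2 ?_
        rw [Matrix.transpose_smul, mul_smul_comm, smul_mul_assoc, ← smul_neg, Matrix.transpose_sub,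
          mul_sub, sub_mul, Matrix.transpose_mul, Matrix.transpose_mul, J_transpose,
          Matrix.transpose_transpose]
        have : J n * (J n * (A * J n)) * J n = A := by
          rw [mul_assoc, mul_assoc, mul_assoc, J_mul_J, mul_one, ← mul_assoc, J_mul_J, one_mul]
        rw [this, neg_sub]⟩
      map_add' := fun A B => by
        apply Subtype.ext
        simp only [Matrix.transpose_add, mul_add, add_mul, Submodule.coe_add, ← smul_add]
        congr 1; abel
      map_smul' := fun c A => by
        apply Subtype.ext
        simp only [Matrix.transpose_smul, mul_smul_comm, smul_mul_assoc, Submodule.coe_smul,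
          RingHom.id_apply, ← smul_sub]
        rw [smul_comm] }

theorem proj_coe {n : ℕ} (X : E n) : proj n X.1 = X := by
  apply Subtype.ext
  change (1 / 2 : ℝ) • (X.1 - J n * X.1ᵀ * J n) = X.1
  rw [(mem_𝔬 _).1 X.2, sub_neg_eq_add, ← two_smul ℝ X.1, smul_smul]
  norm_num

instance (n : ℕ) (m : ℕ∞ω) : IsManifold (I n) m (O n) := by
  apply isManifold_of_contDiffOn
  rintro _ _ ⟨g, rfl⟩ ⟨h, rfl⟩
  intro X hX
  have hX1 : X ∈ (chartO g).target := hX.1.1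
  have hX2 : (chartO g).symm X ∈ (chartO h).source := hX.1.2
  apply ContDiffAt.contDiffWithinAt
  rw [mem_chartO_source, incl_chartO_symm g hX1] at hX2
  have h1 : ContDiffAt ℝ m (fun Y : E n => yac Y.1) X :=
    (contDiffAt_yac ((mem_chartO_target g X).1 hX1) m).comp X
      (𝔬 n).toSubmodule.subtypeL.contDiff.contDiffAt
  have h2 : ContDiffAt ℝ m (fun Y : E n => incl n h⁻¹ * (incl n g * yac Y.1)) X :=
    contDiffAt_const.mul (contDiffAt_const.mul h1)
  have h3 : ContDiffAt ℝ m (fun Y : E n => cay (incl n h⁻¹ * (incl n g * yac Y.1))) X :=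
    ContDiffAt.comp (g := cay) X (contDiffAt_cay hX2 m) h2
  have h4 : ContDiffAt ℝ m
      (fun Y : E n => proj n (cay (incl n h⁻¹ * (incl n g * yac Y.1)))) X :=
    (proj n).contDiff.contDiffAt.comp X h3
  refine h4.congr_of_eventuallyEq ?_
  filter_upwards [(chartO g).open_target.mem_nhds hX1] with Y hY
  rw [← incl_chartO_symm g hY, ← chartO_apply, proj_coe]
  rfl

theorem contMDiff_incl (n : ℕ) (m : ℕ∞ω) : ContMDiff (I n) 𝓘(ℝ, Mat n) m (incl n) := by
  intro g
  rw [contMDiffAt_iff]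
  refine ⟨(continuous_incl n).continuousAt, ?_⟩
  apply ContDiffAt.contDiffWithinAt
  have hg : chartO g g ∈ (chartO g).target := (chartO g).map_source (mem_chart_source (E n) g)
  have h1 : ContDiffAt ℝ m (fun Y : E n => incl n g * yac Y.1) (chartO g g) :=
    contDiffAt_const.mul ((contDiffAt_yac ((mem_chartO_target g _).1 hg) m).comp (chartO g g)
      (𝔬 n).toSubmodule.subtypeL.contDiff.contDiffAt)
  refine h1.congr_of_eventuallyEq ?_
  filter_upwards [(chartO g).open_target.mem_nhds hg] with Y hY
  exact incl_chartO_symm g hY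

theorem contMDiff_of_incl {n : ℕ} {m : ℕ∞ω} {E' H' M : Type*} [NormedAddCommGroup E']
    [NormedSpace ℝ E'] [TopologicalSpace H'] {I' : ModelWithCorners ℝ E' H'}
    [TopologicalSpace M] [ChartedSpace H' M] {f : M → O n}
    (hf : ContMDiff I' 𝓘(ℝ, Mat n) m (fun x => incl n (f x))) : ContMDiff I' (I n) m f := by
  intro x
  rw [contMDiffAt_iff_target]
  refine ⟨((isInducing_incl n).continuous_iff.2 hf.continuous).continuousAt, ?_⟩
  have hx := (mem_chartO_source _ _).1 (mem_chart_source (E n) (f x))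
  have h1 : ContDiffAt ℝ m (fun A : Mat n => proj n (cay (incl n (f x)⁻¹ * A))) (incl n (f x)) :=
    (proj n).contDiff.contDiffAt.comp _ (ContDiffAt.comp (g := cay) _ (contDiffAt_cay hx m)
      (contDiffAt_const.mul contDiffAt_id))
  refine (ContMDiffAt.comp x h1.contMDiffAt (hf x)).congr_of_eventuallyEq ?_
  refine Filter.Eventually.of_forall fun y => ?_
  change chartO (f x) (f y) = proj n (cay (incl n (f x)⁻¹ * incl n (f y)))
  rw [← chartO_apply, proj_coe]

instance (n : ℕ) (m : ℕ∞ω) : LieGroup (I n) m (O n) where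
  contMDiff_mul := by
    apply contMDiff_of_incl
    have h : ContDiff ℝ m (fun p : Mat n × Mat n => p.1 * p.2) := contDiff_fst.mul contDiff_snd
    exact h.contMDiff.comp (((contMDiff_incl n m).comp contMDiff_fst).prodMk_space
      ((contMDiff_incl n m).comp contMDiff_snd))
  contMDiff_inv := by
    apply contMDiff_of_incl
    have h : ContDiff ℝ m (fun A : Mat n => J n * Aᵀ * J n) :=
      (contDiff_const.mul (LinearMap.toContinuousLinearMap
        (Matrix.transposeLinearEquiv (Fin n ⊕ Fin 1) (Fin n ⊕ Fin 1) ℝ ℝ).toLinearMap).contDiff).mul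
          contDiff_const
    refine (h.contMDiff.comp (contMDiff_incl n m)).congr fun A => ?_
    exact incl_inv A

theorem hasFDerivAt_yac (n : ℕ) :
    HasFDerivAt (yac (n := n)) (ContinuousLinearMap.id ℝ (Mat n)) 0 := by
  have hu : IsUnit (2 - (0 : Mat n)).det := by
    rw [sub_zero, ← one_add_one_eq_two]; exact isUnit_det_one_add_one n
  have h2 : DifferentiableAt ℝ (fun B : Mat n => (2 - B)⁻¹) 0 :=
    (ContDiffAt.comp (g := fun B : Mat n => B⁻¹) (f := fun B : Mat n => 2 - B) 0
      (contDiffAt_inv hu 1) (contDiffAt_const.sub contDiffAt_id)).differentiableAt (by simp)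
  have h3 := (((hasFDerivAt_id (0 : Mat n)).mul' h2.hasFDerivAt).const_smul (2 : ℝ)).add_const 1
  have h4 : (2 : ℝ) • (2 : Mat n)⁻¹ = 1 := by
    have : (2 : Mat n) * (2 : Mat n)⁻¹ = 1 := by
      rw [sub_zero] at hu; exact Matrix.mul_nonsing_inv _ hu
    rw [Algebra.smul_def]; exact this
  have h5 := h3.congr_of_eventuallyEq (f₁ := yac (n := n)) (by
    filter_upwards [((isOpen_isUnit_det n).preimage
      ((continuous_const (y := (2 : Mat n))).sub continuous_id)).mem_nhds hu] with B hB
    have := yac_sub_one hB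
    rw [sub_eq_iff_eq_add] at this
    exact this)
  refine h5.congr_fderiv ?_
  ext1 X
  simp only [id_eq, zero_smul, zero_add, sub_zero]
  change (2 : ℝ) • (X * (2 : Mat n)⁻¹) = X
  rw [← mul_smul_comm, h4, mul_one]

/-- The tangent space of `O(n,1)` at `1` is `𝔬(n,1)`, identified through the inclusion of `O(n,1)`
into the space of matrices. -/
theorem mfderiv_incl_one (n : ℕ) (X : TangentSpace (I n) (1 : O n)) :
    mfderiv (I n) 𝓘(ℝ, Mat n) (incl n) 1 X = (show E n from X).1 := by
  have hd : MDifferentiableAt (I n) 𝓘(ℝ, Mat n) (incl n) 1 :=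
    (contMDiff_incl n 1 1).mdifferentiableAt (by simp)
  rw [hd.mfderiv]
  have h0 : extChartAt (I n) (1 : O n) 1 = (0 : E n) := by
    apply Subtype.ext
    change cay (incl n (1⁻¹ * 1)) = 0
    rw [inv_mul_cancel, show incl n 1 = 1 from rfl, cay, sub_self, zero_mul, smul_zero]
  have h1 : HasFDerivAt (fun Y : E n => yac Y.1) (𝔬 n).toSubmodule.subtypeL 0 :=
    HasFDerivAt.comp (g := yac) (g' := ContinuousLinearMap.id ℝ (Mat n)) (0 : E n) (hasFDerivAt_yac n)
      (𝔬 n).toSubmodule.subtypeL.hasFDerivAt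
  have hg : (0 : E n) ∈ (chartO (1 : O n)).target := by
    rw [mem_chartO_target]
    change IsUnit (2 - (0 : Mat n)).det
    rw [sub_zero, ← one_add_one_eq_two]; exact isUnit_det_one_add_one n
  have h2 := h1.congr_of_eventuallyEq
    (f₁ := writtenInExtChartAt (I n) 𝓘(ℝ, Mat n) (1 : O n) (incl n)) (by
      filter_upwards [(chartO (1 : O n)).open_target.mem_nhds hg] with Y hY
      change incl n ((chartO (1 : O n)).symm Y) = _
      rw [incl_chartO_symm _ hY]
      exact one_mul _)
  rw [h0, h2.hasFDerivWithinAt.fderivWithin (by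
    rw [ModelWithCorners.range_eq_univ]; exact uniqueDiffWithinAt_univ)]
  rfl

/-- The left-invariant vector field `x ↦ d(L_x)(X)` with value `X ∈ 𝔬(n,1) = T₁O(n,1)` at `1`. -/
def leftInvariant {n : ℕ} (X : 𝔬 n) : Π x : O n, TangentSpace (I n) x :=
  mulInvariantVectorField (show GroupLieAlgebra (I n) (O n) from X)

/-- Translation of a tangent vector at `x` to the identity, `u ↦ d(L_{x⁻¹})(u)`; the result is a
tangent vector at `x⁻¹ x = 1`, that is, an element of `𝔬(n,1)`. -/
def toLie {n : ℕ} (x : O n) : TangentSpace (I n) x →ₗ[ℝ] 𝔬 n :=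
  (mfderiv (I n) (I n) (fun y : O n => x⁻¹ * y) x).toLinearMap

/-- The Cartan involution `θ(X) = -Xᵀ` of `𝔬(n,1)`. -/
def θ (n : ℕ) : 𝔬 n →ₗ[ℝ] 𝔬 n where
  toFun X := ⟨-(X : Mat n)ᵀ, by
    have hX := (mem_𝔬 _).1 X.2
    refine (mem_𝔬 _).2 ?_
    have h := congrArg Matrix.transpose hX
    rw [Matrix.transpose_mul, Matrix.transpose_mul, J_transpose, Matrix.transpose_transpose,
      Matrix.transpose_neg, ← mul_assoc] at h
    rw [Matrix.transpose_neg, Matrix.transpose_transpose, mul_neg, neg_mul, h]⟩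
  map_add' X Y := by
    apply Subtype.ext
    change -(X.1 + Y.1)ᵀ = -X.1ᵀ + -Y.1ᵀ
    rw [Matrix.transpose_add, neg_add]
  map_smul' c X := by
    apply Subtype.ext
    change -(c • X.1)ᵀ = c • -X.1ᵀ
    rw [Matrix.transpose_smul, smul_neg]

/-- The form `B_θ(X, Y) = -B(X, θ Y)`, where `B` is the Killing form of `𝔬(n,1)`. -/
def Bθ (n : ℕ) : LinearMap.BilinForm ℝ (𝔬 n) :=
  -(killingForm ℝ (𝔬 n)).compl₂ (θ n)

/-- The canonical metric `g₀`: the left-invariant metric on `O(n,1)` induced by `B_θ`. -/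
def g₀ (n : ℕ) (x : O n) : LinearMap.BilinForm ℝ (TangentSpace (I n) x) :=
  (Bθ n).compl₁₂ (toLie x) (toLie x)

/-- The normalized metric `g̃₀ = g₀ / (2(n-1))`. -/
def gTilde (n : ℕ) (x : O n) : LinearMap.BilinForm ℝ (TangentSpace (I n) x) :=
  (1 / (2 * ((n : ℝ) - 1))) • g₀ n x

/-- `α_ij = e_ij - e_ji`. -/
def α {n : ℕ} (i j : Fin n) : 𝔬 n :=
  ⟨Matrix.single (Sum.inl i) (Sum.inl j) 1 - Matrix.single (Sum.inl j) (Sum.inl i) 1, by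
    rw [mem_𝔬, J, indefiniteDiagonal]
    ext a b
    rw [Matrix.mul_diagonal, Matrix.diagonal_mul]
    rcases a with a | a <;> rcases b with b | b <;>
      simp only [Matrix.single_apply, Matrix.sub_apply, Matrix.transpose_apply, Matrix.neg_apply] <;> grind⟩

/-- `σ_{k,n+1} = e_{k,n+1} + e_{n+1,k}`. -/
def σ {n : ℕ} (k : Fin n) : 𝔬 n :=
  ⟨Matrix.single (Sum.inl k) (Sum.inr 0) 1 + Matrix.single (Sum.inr 0) (Sum.inl k) 1, by
    rw [mem_𝔬, J, indefiniteDiagonal]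
    ext a b
    rw [Matrix.mul_diagonal, Matrix.diagonal_mul]
    rcases a with a | a <;> rcases b with b | b <;>
      simp [Matrix.single_apply, and_comm, apply_ite]⟩

/-- The standard basis `{α_ij : i < j} ∪ {σ_{k,n+1}}` of `𝔬(n,1)`. -/
def standardBasis (n : ℕ) : Set (𝔬 n) :=
  {X | (∃ i j : Fin n, i < j ∧ X = α i j) ∨ ∃ k : Fin n, X = σ k}

end Lorentz

namespace Riemannian

variable {E : Type*} [NormedAddCommGroup E] [NormedSpace ℝ E] [FiniteDimensional ℝ E]
  [CompleteSpace E]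
  {H : Type*} [TopologicalSpace H] {I : ModelWithCorners ℝ E H}
  {M : Type*} [TopologicalSpace M] [ChartedSpace H M] [IsManifold I 2 M]

/-- `∇` is the Levi-Civita connection of the metric `g`: it is torsion free and
`v⟨Y, Z⟩ = ⟨∇_v Y, Z⟩ + ⟨Y, ∇_v Z⟩`.  In Mathlib's notation `cov Y x v` is `(∇_v Y)(x)`. -/
structure IsLeviCivita (g : Π x : M, LinearMap.BilinForm ℝ (TangentSpace I x))
    (cov : CovariantDerivative I E (TangentSpace I : M → Type _)) : Prop where
  torsion_eq_zero : cov.torsion = 0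
  metric : ∀ (Y Z : Π x : M, TangentSpace I x) (x : M) (v : TangentSpace I x),
    MDiffAt (T% Y) x → MDiffAt (T% Z) x →
      d% (fun y => g y (Y y) (Z y)) x v = g x (cov Y x v) (Z x) + g x (Y x) (cov Z x v)

/-- `R(X,Y)Z = ∇_X ∇_Y Z - ∇_Y ∇_X Z - ∇_[X,Y] Z`. -/
def curvature (cov : CovariantDerivative I E (TangentSpace I : M → Type _))
    (X Y Z : Π x : M, TangentSpace I x) (x : M) : TangentSpace I x :=
  cov (fun y => cov Z y (Y y)) x (X x) - cov (fun y => cov Z y (X y)) x (Y x)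
    - cov Z x (VectorField.mlieBracket I X Y x)

/-- `K(X,Y) = ⟨R(X,Y)Y, X⟩ / (‖X‖²‖Y‖² - ⟨X,Y⟩²)` at the point `x`. -/
def sectionalCurvature (g : Π x : M, LinearMap.BilinForm ℝ (TangentSpace I x))
    (cov : CovariantDerivative I E (TangentSpace I : M → Type _))
    (X Y : Π x : M, TangentSpace I x) (x : M) : ℝ :=
  g x (curvature cov X Y Y x) (X x) /
    (g x (X x) (X x) * g x (Y x) (Y x) - g x (X x) (Y x) ^ 2)

end Riemannian

end

/-! ### Traces of operators on the space of matrices -/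

namespace Matrix

variable {ι R : Type*} [Fintype ι] [DecidableEq ι] [CommRing R]

/-! On left-invariant fields everything reduces to algebra in `𝔬 n`. The Killing form is `(n-1)
tr(XY)` (`killingForm_eq`), so the normalization turns the metric at the identity into `½ tr(X Yᵀ)`,
for which the standard basis is orthonormal. The adjoint of `ad X` for this product is `-ad (θ X)`,
so the Koszul formula gives `∇_X Y = ½([X,Y] + [θY,X] + [θX,Y])` (`eq_leviCivitaProduct`).

Every basis element is an eigenvector of `θ`, with eigenvalue `1` for the `α_ij` and `-1` for the
`σ_k`. If `θX = aX` and `θY = bY`, then `∇_X Y` is `(1+a-b)/2` times `[X,Y]`, and `[X,Y]` is again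
an eigenvector, with eigenvalue `ab`. Hence `⟨R(X,Y)Y,X⟩ = c(a,b) ‖[X,Y]‖²` (`halfTrace_curvature`),
where `c = 1/4` if at least one of the two is an `α`, and `c = -7/4` for two `σ`'s. The bracket of
two distinct basis elements is zero or, up to sign, a basis element, so `‖[X,Y]‖² ≤ 1`, and both
bounds follow.

What remains is the passage from the manifold to the algebra: the Lie bracket of left-invariant
vector fields on `O n` must be the matrix commutator (`mlieBracket_leftInvariant`). This is a
computation at the origin of the Cayley chart, where such a field is the quadratic polynomial
`¼(2+u)X(2-u)`. -/

theorem linearMap_trace_eq_sum (f : Matrix ι ι R →ₗ[R] Matrix ι ι R) :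
    LinearMap.trace R _ f = ∑ i, ∑ j, f (single i j 1) i j := by
  rw [LinearMap.trace_eq_matrix_trace R (stdBasis R ι ι), Matrix.trace, Fintype.sum_prod_type]
  refine Finset.sum_congr rfl fun i _ => Finset.sum_congr rfl fun j _ => ?_
  rw [diag_apply, LinearMap.toMatrix_apply, stdBasis_eq_single]
  rfl

theorem linearMap_trace_of_apply_eq_mul_mul {f : Matrix ι ι R →ₗ[R] Matrix ι ι R}
    {L K : Matrix ι ι R} (h : ∀ A, f A = L * A * K) :
    LinearMap.trace R _ f = L.trace * K.trace := by
  rw [linearMap_trace_eq_sum, Matrix.trace, Matrix.trace, Finset.sum_mul_sum]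
  refine Finset.sum_congr rfl fun i _ => Finset.sum_congr rfl fun j _ => ?_
  simp [h, mul_apply, single_apply, ite_and, Finset.sum_ite_eq]

/-- The transpose sends `e_ij` to `e_ji`, so the diagonal coefficient is `L i j * K i j` rather than
`L i i * K j j`. -/
theorem linearMap_trace_of_apply_eq_mul_transpose_mul {f : Matrix ι ι R →ₗ[R] Matrix ι ι R}
    {L K : Matrix ι ι R} (h : ∀ A, f A = L * Aᵀ * K) :
    LinearMap.trace R _ f = (L * Kᵀ).trace := by
  rw [linearMap_trace_eq_sum, Matrix.trace]
  refine Finset.sum_congr rfl fun i _ => ?_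
  rw [diag_apply, mul_apply]
  refine Finset.sum_congr rfl fun j _ => ?_
  simp [h, mul_apply, single_apply, ite_and, Finset.sum_ite_eq]

end Matrix

noncomputable section

namespace Lorentz

variable {n : ℕ}

/-! ### The Killing form and the normalized inner product -/

theorem trace_J_mul_transpose_mul_J (A : Mat n) : (J n * Aᵀ * J n).trace = A.trace := by
  rw [Matrix.trace_mul_comm, ← mul_assoc, J_mul_J, one_mul, Matrix.trace_transpose]

theorem trace_coe_eq_zero (X : 𝔬 n) : (X : Mat n).trace = 0 := by
  have h := trace_J_mul_transpose_mul_J (X : Mat n)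
  rw [(mem_𝔬 _).1 X.2, Matrix.trace_neg] at h
  linarith

theorem coe_bracket (X Y : 𝔬 n) : ((⁅X, Y⁆ : 𝔬 n) : Mat n) = X.1 * Y.1 - Y.1 * X.1 := rfl

/-- With `τ(A) = J Aᵀ J`, the map `½(1 - τ)` projects all matrices onto `𝔬 n`, so the trace over `𝔬
n` is half the trace of `S - S ∘ τ` over matrices, where `S(A) = xyA - xAy - yAx + Ayx`. The first
part contributes `2(n+1) tr(xy)`, because `x` and `y` are traceless, and the second `4 tr(xy)`; half
the difference is `(n-1) tr(xy)`. -/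
theorem killingForm_eq (X Y : 𝔬 n) :
    killingForm ℝ (𝔬 n) X Y = ((n : ℝ) - 1) * (X.1 * Y.1).trace := by
  let P : Mat n →ₗ[ℝ] 𝔬 n := (proj n).toLinearMap
  let ι : 𝔬 n →ₗ[ℝ] Mat n := (𝔬 n).toSubmodule.subtype
  have hP : P ∘ₗ ι = LinearMap.id := LinearMap.ext fun Z => proj_coe Z
  let x := X.1
  let y := Y.1
  have hx : J n * xᵀ * J n = -x := (mem_𝔬 _).1 X.2
  have hy : J n * yᵀ * J n = -y := (mem_𝔬 _).1 Y.2
  let ml (A B : Mat n) : Mat n →ₗ[ℝ] Mat n := LinearMap.mulLeft ℝ A ∘ₗ LinearMap.mulRight ℝ B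
  let T : Mat n →ₗ[ℝ] Mat n := (Matrix.transposeLinearEquiv (Fin n ⊕ Fin 1) (Fin n ⊕ Fin 1) ℝ ℝ).toLinearMap
  have hml (A B : Mat n) : LinearMap.trace ℝ _ (ml A B) = A.trace * B.trace :=
    Matrix.linearMap_trace_of_apply_eq_mul_mul fun C => (mul_assoc A C B).symm
  have hmt (A B : Mat n) : LinearMap.trace ℝ _ (ml A B ∘ₗ ml (J n) (J n) ∘ₗ T) =
      (A * (J n * Bᵀ * J n)).trace := by
    rw [Matrix.linearMap_trace_of_apply_eq_mul_transpose_mul (L := A * J n) (K := J n * B)]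
    · rw [Matrix.transpose_mul, J_transpose]
      simp only [mul_assoc]
    · intro C
      change A * ((J n * (Cᵀ * J n)) * B) = _
      simp only [mul_assoc]
  let S : Mat n →ₗ[ℝ] Mat n := ml (x * y) 1 - ml x y - ml y x + ml 1 (y * x)
  have hS : ι ∘ₗ (LieAlgebra.ad ℝ (𝔬 n) X ∘ₗ LieAlgebra.ad ℝ (𝔬 n) Y) ∘ₗ P
      = (1 / 2 : ℝ) • (S - S ∘ₗ ml (J n) (J n) ∘ₗ T) := by
    ext1 A
    have h1 : ((P A : 𝔬 n) : Mat n) = (1 / 2 : ℝ) • (A - J n * Aᵀ * J n) := rfl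
    have h2 (B : Mat n) : S B = x * y * B - x * B * y - y * B * x + B * (y * x) := by
      change (x * y) * (B * 1) - x * (B * y) - y * (B * x) + 1 * (B * (y * x)) = _
      simp only [mul_one, one_mul, mul_assoc]
    have h3 (Z : 𝔬 n) : ((⁅X, ⁅Y, Z⁆⁆ : 𝔬 n) : Mat n) = S Z.1 := by
      rw [coe_bracket, coe_bracket, h2]
      noncomm_ring
    change ((⁅X, ⁅Y, P A⁆⁆ : 𝔬 n) : Mat n) = (1 / 2 : ℝ) • (S A - S (J n * (Aᵀ * J n)))
    rw [h3, h1, map_smul, map_sub, mul_assoc]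
  -- By cyclicity of the trace, inserting `P` and `ι` around an endomorphism of `𝔬 n` changes
  -- nothing, since `P ∘ ι` is the identity.
  have key : LinearMap.trace ℝ (𝔬 n) (LieAlgebra.ad ℝ (𝔬 n) X ∘ₗ LieAlgebra.ad ℝ (𝔬 n) Y)
      = LinearMap.trace ℝ (Mat n) ((1 / 2 : ℝ) • (S - S ∘ₗ ml (J n) (J n) ∘ₗ T)) := by
    rw [← hS, LinearMap.trace_comp_comm' _ ι, LinearMap.comp_assoc ι P, hP, LinearMap.comp_id]
  rw [killingForm_apply_apply, key]
  have hyx : J n * (y * x)ᵀ * J n = x * y := by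
    rw [J_conj_mul, hx, hy, neg_mul_neg]
  have hx0 : x.trace = 0 := trace_coe_eq_zero X
  have hy0 : y.trace = 0 := trace_coe_eq_zero Y
  have h1 : (1 : Mat n).trace = (n : ℝ) + 1 := by simp
  have hyx' : (y * x).trace = (x * y).trace := Matrix.trace_mul_comm _ _
  simp only [S, LinearMap.add_comp, LinearMap.sub_comp, map_smul, map_sub, map_add, hml, hmt, hx,
    hy, hyx, hx0, hy0, h1, Matrix.transpose_one, mul_one, one_mul, J_mul_J, mul_neg,
    Matrix.trace_neg, hyx', smul_eq_mul]
  change _ = _ * (x * y).trace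
  ring

/-- The form `½ tr(X Yᵀ)` on `𝔬(n,1)`. -/
def halfTrace (n : ℕ) : LinearMap.BilinForm ℝ (𝔬 n) :=
  LinearMap.mk₂ ℝ (fun X Y => (1 / 2 : ℝ) * (X.1 * Y.1ᵀ).trace)
    (fun X X' Y => by
      change (1 / 2 : ℝ) * ((X.1 + X'.1) * Y.1ᵀ).trace = _
      rw [add_mul, Matrix.trace_add, mul_add])
    (fun c X Y => by
      change (1 / 2 : ℝ) * ((c • X.1) * Y.1ᵀ).trace = _
      rw [smul_mul_assoc, Matrix.trace_smul, smul_eq_mul, smul_eq_mul, mul_left_comm])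
    (fun X Y Y' => by
      change (1 / 2 : ℝ) * (X.1 * (Y.1 + Y'.1)ᵀ).trace = _
      rw [Matrix.transpose_add, mul_add, Matrix.trace_add, mul_add])
    (fun c X Y => by
      change (1 / 2 : ℝ) * (X.1 * (c • Y.1)ᵀ).trace = _
      rw [Matrix.transpose_smul, mul_smul_comm, Matrix.trace_smul, smul_eq_mul, smul_eq_mul,
        mul_left_comm])

theorem halfTrace_apply (X Y : 𝔬 n) : halfTrace n X Y = (1 / 2 : ℝ) * (X.1 * Y.1ᵀ).trace := rfl

theorem coe_θ (X : 𝔬 n) : ((θ n X : 𝔬 n) : Mat n) = -X.1ᵀ := rfl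

theorem smul_Bθ_eq_halfTrace (hn : 2 ≤ n) :
    (1 / (2 * ((n : ℝ) - 1))) • Bθ n = halfTrace n := by
  have hn' : (2 : ℝ) ≤ n := by exact_mod_cast hn
  ext X Y
  have h : Bθ n X Y = -killingForm ℝ (𝔬 n) X (θ n Y) := rfl
  rw [LinearMap.smul_apply, LinearMap.smul_apply, h, killingForm_eq, coe_θ, mul_neg,
    Matrix.trace_neg, halfTrace_apply, smul_eq_mul]
  have : (n : ℝ) - 1 ≠ 0 := by linarith
  field_simp

theorem halfTrace_comm (X Y : 𝔬 n) : halfTrace n X Y = halfTrace n Y X := by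
  rw [halfTrace_apply, halfTrace_apply, ← Matrix.trace_transpose, Matrix.transpose_mul,
    Matrix.transpose_transpose]

theorem halfTrace_self_eq_zero {X : 𝔬 n} (h : halfTrace n X X = 0) : X = 0 := by
  rw [halfTrace_apply] at h
  have h1 : (X.1 * X.1ᵀ).trace = 0 := by linarith
  rw [← Matrix.conjTranspose_eq_transpose_of_trivial,
    Matrix.trace_mul_conjTranspose_self_eq_zero_iff] at h1
  exact Subtype.ext h1

theorem halfTrace_left_injective {X Y : 𝔬 n} (h : ∀ Z, halfTrace n X Z = halfTrace n Y Z) :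
    X = Y := by
  rw [← sub_eq_zero]
  apply halfTrace_self_eq_zero
  rw [map_sub (halfTrace n), LinearMap.sub_apply, h, sub_self]

/-- The adjoint of `ad X` for `½ tr(X Yᵀ)` is `ad Xᵀ = -ad (θ X)`, by cyclicity of the trace. This
is the source of the `θ` terms in the Koszul formula. -/
theorem halfTrace_bracket_left (X Y Z : 𝔬 n) :
    halfTrace n ⁅X, Y⁆ Z = -halfTrace n Y ⁅θ n X, Z⁆ := by
  rw [halfTrace_apply, halfTrace_apply, coe_bracket, coe_bracket, coe_θ]
  simp only [Matrix.transpose_sub, Matrix.transpose_mul, Matrix.transpose_neg,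
    Matrix.transpose_transpose, sub_mul, mul_sub, Matrix.trace_sub, mul_neg, neg_mul,
    Matrix.trace_neg]
  rw [mul_assoc X.1, Matrix.trace_mul_comm X.1]
  simp only [mul_assoc]
  ring

theorem θ_bracket (X Y : 𝔬 n) : θ n ⁅X, Y⁆ = ⁅θ n X, θ n Y⁆ := by
  apply Subtype.ext
  rw [coe_θ, coe_bracket, coe_bracket, coe_θ, coe_θ, Matrix.transpose_sub, Matrix.transpose_mul,
    Matrix.transpose_mul]
  noncomm_ring

/-! ### Connection and curvature in the Lie algebra -/

/-- The Levi-Civita connection of the left-invariant metric `½ tr(X Yᵀ)`, on left-invariant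
fields. -/
def leviCivitaProduct (X Y : 𝔬 n) : 𝔬 n := (1 / 2 : ℝ) • (⁅X, Y⁆ + ⁅θ n Y, X⁆ + ⁅θ n X, Y⁆)

/-- The Koszul formula. -/
theorem eq_leviCivitaProduct {D : 𝔬 n → 𝔬 n → 𝔬 n} (hT : ∀ X Y, D X Y - D Y X = ⁅X, Y⁆)
    (hM : ∀ X Y Z, halfTrace n (D X Y) Z + halfTrace n Y (D X Z) = 0) (X Y : 𝔬 n) :
    D X Y = leviCivitaProduct X Y := by
  apply halfTrace_left_injective
  intro Z
  have hT' (X Y Z : 𝔬 n) :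
      halfTrace n (D X Y) Z - halfTrace n (D Y X) Z = halfTrace n ⁅X, Y⁆ Z := by
    rw [← hT, map_sub, LinearMap.sub_apply]
  -- As in the classical Koszul argument, three metric identities and three torsion identities
  -- determine `⟨D X Y, Z⟩`. Adjointness then frees `Z` from the brackets that contain it.
  have a1 := hM X Y Z
  have a2 := hM Y X Z
  have a3 := hM Z X Y
  have b1 := hT' X Y Z
  have b2 := hT' X Z Y
  have b3 := hT' Y Z X
  have c2 := halfTrace_bracket_left X Z Y
  have c3 := halfTrace_bracket_left Y Z X
  rw [halfTrace_comm Y] at a1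
  rw [halfTrace_comm X] at a2 a3
  rw [halfTrace_comm Z] at c2 c3
  rw [leviCivitaProduct, map_smul, LinearMap.smul_apply, map_add, map_add, LinearMap.add_apply,
    LinearMap.add_apply, smul_eq_mul]
  linarith

theorem leviCivitaProduct_of_θ_eq_smul {X Y : 𝔬 n} {a b : ℝ} (hX : θ n X = a • X)
    (hY : θ n Y = b • Y) : leviCivitaProduct X Y = ((1 + a - b) / 2) • ⁅X, Y⁆ := by
  rw [leviCivitaProduct, hX, hY, smul_lie, smul_lie, ← lie_skew X Y]
  module

/-- The term `∇_X ∇_Y Y` vanishes because `∇_Y Y` is a multiple of `[Y,Y]`. The other two are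
multiples of `[Y,[X,Y]]`, since `[X,Y]` has eigenvalue `ab`, and pairing with `X` gives the factor
`b ‖[X,Y]‖²`. At `a, b = ±1` the coefficient is `1/4`, except `-7/4` at `a = b = -1`. -/
theorem halfTrace_curvature {X Y : 𝔬 n} {a b : ℝ} (hX : θ n X = a • X)
    (hY : θ n Y = b • Y) :
    halfTrace n (leviCivitaProduct X (leviCivitaProduct Y Y)
      - leviCivitaProduct Y (leviCivitaProduct X Y) - leviCivitaProduct ⁅X, Y⁆ Y) X =
      b * ((1 + a * b - b) / 2 - (1 + a - b) * (1 + b - a * b) / 4) *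
        halfTrace n ⁅X, Y⁆ ⁅X, Y⁆ := by
  have hZ : θ n ⁅X, Y⁆ = (a * b) • ⁅X, Y⁆ := by
    rw [θ_bracket, hX, hY, smul_lie, lie_smul, smul_smul]
  have hcZ (c : ℝ) : θ n (c • ⁅X, Y⁆) = (a * b) • c • ⁅X, Y⁆ := by
    rw [map_smul, hZ, smul_comm]
  have h0 : leviCivitaProduct X (0 : 𝔬 n) = 0 := by simp [leviCivitaProduct]
  have h1 : halfTrace n ⁅Y, ⁅X, Y⁆⁆ X = b * halfTrace n ⁅X, Y⁆ ⁅X, Y⁆ := by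
    rw [halfTrace_bracket_left, hY, smul_lie, map_smul, ← lie_skew Y X, map_neg, smul_eq_mul]
    ring
  have h2 : halfTrace n ⁅⁅X, Y⁆, Y⁆ X = -(b * halfTrace n ⁅X, Y⁆ ⁅X, Y⁆) := by
    rw [← h1, ← lie_skew, map_neg, LinearMap.neg_apply]
  rw [leviCivitaProduct_of_θ_eq_smul hY hY, lie_self, smul_zero, h0,
    leviCivitaProduct_of_θ_eq_smul hX hY, leviCivitaProduct_of_θ_eq_smul hZ hY,
    leviCivitaProduct_of_θ_eq_smul hY (hcZ _), lie_smul]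
  simp only [map_sub, map_smul, map_zero, LinearMap.sub_apply, LinearMap.smul_apply,
    LinearMap.zero_apply, h1, h2, smul_eq_mul]
  ring

/-! ### The standard basis: eigenvalues, brackets, inner products -/

theorem θ_α (i j : Fin n) : θ n (α i j) = (1 : ℝ) • α i j := by
  apply Subtype.ext
  rw [one_smul]
  simp [coe_θ, α]

theorem θ_σ (i : Fin n) : θ n (σ i) = (-1 : ℝ) • σ i := by
  apply Subtype.ext
  rw [neg_one_smul]
  change _ = -(σ i).1
  simp [coe_θ, σ, add_comm]

theorem single_mul_single (i j k l : Fin n ⊕ Fin 1) :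
    (Matrix.single i j 1 * Matrix.single k l 1 : Mat n) =
      if j = k then Matrix.single i l 1 else 0 := by
  split_ifs with h
  · rw [h, Matrix.single_mul_single_same, one_mul]
  · exact Matrix.single_mul_single_of_ne _ _ _ _ h _

theorem trace_single (i j : Fin n ⊕ Fin 1) :
    (Matrix.single i j 1 : Mat n).trace = if i = j then 1 else 0 := by
  split_ifs with h
  · rw [h, Matrix.trace_single_eq_same]
  · exact Matrix.trace_single_eq_of_ne _ _ _ h

theorem coe_α (i j : Fin n) : ((α i j : 𝔬 n) : Mat n) =
    Matrix.single (Sum.inl i) (Sum.inl j) 1 - Matrix.single (Sum.inl j) (Sum.inl i) 1 := rfl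

theorem coe_σ (k : Fin n) : ((σ k : 𝔬 n) : Mat n) =
    Matrix.single (Sum.inl k) (Sum.inr 0) 1 + Matrix.single (Sum.inr 0) (Sum.inl k) 1 := rfl

theorem bracket_α_α (i j k l : Fin n) :
    ⁅α i j, α k l⁆ = (if j = k then α i l else 0) - (if j = l then α i k else 0)
      - (if i = k then α j l else 0) + (if i = l then α j k else 0) := by
  apply Subtype.ext
  simp only [coe_bracket, AddSubgroupClass.coe_sub, AddMemClass.coe_add, apply_ite Subtype.val,
    coe_α, mul_sub, sub_mul, single_mul_single, Sum.inl.injEq, ZeroMemClass.coe_zero,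
    eq_comm (a := k), eq_comm (a := l)]
  split_ifs <;> abel

theorem bracket_α_σ (i j k : Fin n) :
    ⁅α i j, σ k⁆ = (if j = k then σ i else 0) - (if i = k then σ j else 0) := by
  apply Subtype.ext
  simp only [coe_bracket, AddSubgroupClass.coe_sub, apply_ite Subtype.val,
    coe_α, coe_σ, mul_sub, sub_mul, mul_add, add_mul, single_mul_single, Sum.inl.injEq,
    ZeroMemClass.coe_zero, reduceCtorEq, if_false, eq_comm (a := k)]
  split_ifs <;> abel

theorem bracket_σ_σ (i j : Fin n) : ⁅σ i, σ j⁆ = α i j := by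
  apply Subtype.ext
  simp only [coe_bracket, coe_α, coe_σ, mul_add, add_mul, single_mul_single, Sum.inl.injEq,
    reduceCtorEq, if_false, if_true, eq_comm (a := j)]
  split_ifs <;> abel

theorem halfTrace_α_α (i j k l : Fin n) :
    halfTrace n (α i j) (α k l) =
      (if i = k ∧ j = l then 1 else 0) - (if i = l ∧ j = k then 1 else 0) := by
  simp only [halfTrace_apply, coe_α, Matrix.transpose_sub, Matrix.transpose_single, mul_sub,
    sub_mul, single_mul_single, Sum.inl.injEq, Matrix.trace_sub, apply_ite Matrix.trace,
    trace_single, Matrix.trace_zero]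
  grind

theorem halfTrace_σ_σ (i j : Fin n) : halfTrace n (σ i) (σ j) = if i = j then 1 else 0 := by
  simp only [halfTrace_apply, coe_σ, Matrix.transpose_add, Matrix.transpose_single, mul_add,
    add_mul, single_mul_single, Sum.inl.injEq, Matrix.trace_add, apply_ite Matrix.trace,
    trace_single, Matrix.trace_zero, reduceCtorEq, if_false, if_true]
  split_ifs <;> norm_num

theorem halfTrace_α_σ (i j k : Fin n) : halfTrace n (α i j) (σ k) = 0 := by
  simp only [halfTrace_apply, coe_α, coe_σ, Matrix.transpose_add, Matrix.transpose_single,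
    mul_add, sub_mul, single_mul_single, Sum.inl.injEq, Matrix.trace_add, Matrix.trace_sub,
    apply_ite Matrix.trace, trace_single, Matrix.trace_zero, reduceCtorEq, if_false]
  split_ifs <;> norm_num

/-- For distinct increasing pairs at most one of the four Kronecker deltas in `bracket_α_α` is
nonzero, so the bracket is zero or a single `±α`. -/
theorem halfTrace_bracket_α_α_le {i j k l : Fin n} (hij : i < j) (hkl : k < l)
    (h : ¬(i = k ∧ j = l)) : halfTrace n ⁅α i j, α k l⁆ ⁅α i j, α k l⁆ ≤ 1 := by
  have hα (a b : Fin n) : halfTrace n (α a b) (α a b) ≤ 1 := by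
    rw [halfTrace_α_α]
    split_ifs <;> norm_num
  rw [bracket_α_α]
  rcases eq_or_ne j k with hjk | hjk
  · have h1 : j ≠ l := by omega
    have h2 : i ≠ k := by omega
    have h3 : i ≠ l := by omega
    simpa [hjk, h1, h2, h3, hkl.ne] using hα i l
  rcases eq_or_ne i l with hil | hil
  · have h1 : j ≠ l := by omega
    have h2 : i ≠ k := by omega
    simpa [hjk, hil, h1, h2, hkl.ne'] using hα j k
  rcases eq_or_ne i k with hik | hik
  · have h1 : j ≠ l := fun e => h ⟨hik, e⟩
    simpa [hjk, hil, h1, hik, hkl.ne] using hα j l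
  · rcases eq_or_ne j l with hjl | hjl
    · simpa [hjk, hil, hjl, hik, hkl.ne'] using hα i k
    · simp [hjk, hil, hjl, hik]

theorem halfTrace_bracket_α_σ_le (i j k : Fin n) (hij : i ≠ j) :
    halfTrace n ⁅α i j, σ k⁆ ⁅α i j, σ k⁆ ≤ 1 := by
  rw [bracket_α_σ]
  rcases eq_or_ne j k with rfl | hjk
  · simp [hij, halfTrace_σ_σ]
  · rcases eq_or_ne i k with rfl | hik
    · simp [hjk, halfTrace_σ_σ]
    · simp [hjk, hik]

end Lorentz

end

noncomputable section

namespace Lorentz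

variable {n : ℕ}

/-! ### Left-invariant vector fields and the metric -/

theorem mdifferentiableAt_mul_left (x y : O n) :
    MDifferentiableAt (I n) (I n) (fun z : O n => x * z) y :=
  (contMDiff_mul_left (I := I n) (n := 1) (a := x) y).mdifferentiableAt (by simp)

theorem toLie_leftInvariant (X : 𝔬 n) (x : O n) : toLie x (leftInvariant X x) = X := by
  -- The base points `x` and `x * 1` are equal but not definitionally, so the statement is made for
  -- a variable `y` to avoid a transport between tangent spaces.
  have h : ∀ y : O n, y = x * 1 →
      (show E n from mfderiv (I n) (I n) (fun z : O n => x⁻¹ * z) y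
        (show E n from mfderiv (I n) (I n) (fun z : O n => x * z) 1 (show E n from X))) = X := by
    rintro y rfl
    have h1 := mfderiv_comp (I := I n) (I' := I n) (I'' := I n) (1 : O n)
      (mdifferentiableAt_mul_left x⁻¹ (x * 1)) (mdifferentiableAt_mul_left x 1)
    have h2 : (fun z : O n => x⁻¹ * z) ∘ (fun z : O n => x * z) = id :=
      funext fun z => inv_mul_cancel_left x z
    rw [h2, mfderiv_id] at h1
    exact (DFunLike.congr_fun h1 (show E n from X)).symm
  exact h x (mul_one x).symm

theorem toLie_injective (x : O n) : Function.Injective (toLie x) := by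
  have hs : Function.Surjective (toLie x) := fun X => ⟨leftInvariant X x, toLie_leftInvariant X x⟩
  have : FiniteDimensional ℝ (E n) :=
    FiniteDimensional.finiteDimensional_submodule (𝔬 n).toSubmodule
  have h (f : E n →ₗ[ℝ] E n) : Function.Surjective f → Function.Injective f :=
    LinearMap.injective_iff_surjective.2
  exact h (toLie x) hs

theorem gTilde_apply (hn : 2 ≤ n) (x : O n) (u v : TangentSpace (I n) x) :
    gTilde n x u v = halfTrace n (toLie x u) (toLie x v) := by
  rw [← smul_Bθ_eq_halfTrace hn]
  rfl

theorem gTilde_leftInvariant (hn : 2 ≤ n) (X Y : 𝔬 n) (x : O n) :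
    gTilde n x (leftInvariant X x) (leftInvariant Y x) = halfTrace n X Y := by
  rw [gTilde_apply hn, toLie_leftInvariant, toLie_leftInvariant]

theorem mdifferentiableAt_leftInvariant (X : 𝔬 n) (x : O n) :
    MDifferentiableAt (I n) (I n).tangent
      (fun y : O n => (⟨y, leftInvariant X y⟩ : TangentBundle (I n) (O n))) x :=
  mdifferentiableAt_mulInvariantVectorField _

/-! ### The bracket of left-invariant fields, in Cayley charts -/

/-- Differentiating `cay B * (B + 1) = 2 (B - 1)` at `A` along `A * X` avoids differentiating an
inverse. The identities `(2 - cay A) * A = 2 + cay A` and `(A + 1)⁻¹ = ¼ (2 - cay A)` then eliminate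
`A` in favour of its coordinate. -/
theorem fderiv_cay_mul {A : Mat n} (h : IsUnit (A + 1).det) (X : Mat n) :
    fderiv ℝ (cay (n := n)) A (A * X) =
      (1 / 4 : ℝ) • ((2 + cay A) * X * (2 - cay A)) := by
  have hd : DifferentiableAt ℝ (cay (n := n)) A :=
    (contDiffAt_cay h 1).differentiableAt (by simp)
  have h1 : HasFDerivAt (fun B : Mat n => cay B * (B + 1))
      (cay A • ContinuousLinearMap.id ℝ (Mat n) + MulOpposite.op (A + 1) • fderiv ℝ (cay (n := n)) A) A :=
    hd.hasFDerivAt.mul' ((hasFDerivAt_id A).add_const 1)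
  have h2 : HasFDerivAt (fun B : Mat n => (2 : ℝ) • (B - 1))
      ((2 : ℝ) • ContinuousLinearMap.id ℝ (Mat n)) A :=
    ((hasFDerivAt_id A).sub_const 1).const_smul (2 : ℝ)
  have h3 : (fun B : Mat n => cay B * (B + 1)) =ᶠ[nhds A] fun B => (2 : ℝ) • (B - 1) := by
    filter_upwards [((isOpen_isUnit_det n).preimage
      (continuous_id.add (continuous_const (y := (1 : Mat n))))).mem_nhds h] with B hB
    have hB' : IsUnit (B + 1).det := hB
    rw [cay, smul_mul_assoc, Matrix.nonsing_inv_mul_cancel_right _ _ hB']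
  have h4 := DFunLike.congr_fun (h1.unique (h2.congr_of_eventuallyEq h3)) (A * X)
  replace h4 : cay A * (A * X) + fderiv ℝ (cay (n := n)) A (A * X) * (A + 1) =
    (2 : ℝ) • (A * X) := h4
  have h5 : (2 - cay A) * A = 2 + cay A := by
    have hc : (A + 1)⁻¹ * A = A * (A + 1)⁻¹ := by
      have : A = (A + 1) - 1 := by abel
      nth_rw 2 3 [this]
      rw [mul_sub, sub_mul, Matrix.mul_nonsing_inv _ h, Matrix.nonsing_inv_mul _ h, mul_one,
        one_mul]
    rw [two_sub_cay h, two_add_cay h, smul_mul_assoc, hc]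
  have h6 : fderiv ℝ (cay (n := n)) A (A * X) * (A + 1) = (2 + cay A) * X := by
    rw [← h5, mul_assoc, sub_mul, eq_sub_iff_add_eq, add_comm, h4, two_smul, two_mul]
  rw [two_sub_cay h, mul_smul_comm, smul_smul, ← h6,
    Matrix.mul_nonsing_inv_cancel_right _ _ h]
  norm_num

/-- The anti-automorphism `A ↦ J Aᵀ J` exchanges `2 + u` and `2 - u` and negates `X`; reversing the
order of the factors restores the product up to sign. -/
theorem two_add_mul_mul_two_sub_mem (u X : 𝔬 n) : (2 + u.1) * X.1 * (2 - u.1) ∈ 𝔬 n := by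
  have hJ2 : J n * (2 : Mat n)ᵀ * J n = 2 := by
    rw [show (2 : Mat n) = 1 + 1 by norm_num]
    simp [mul_add, add_mul, J_mul_J]
  have hu := (mem_𝔬 _).1 u.2
  rw [mem_𝔬, J_conj_mul, J_conj_mul, (mem_𝔬 _).1 X.2, Matrix.transpose_add, Matrix.transpose_sub,
    mul_add, add_mul, mul_sub, sub_mul, hu, hJ2]
  noncomm_ring

/-- The left-invariant vector field with value `X` at `1`, read in a Cayley chart. -/
def cayleyField (X : 𝔬 n) (u : E n) : E n :=
  (1 / 4 : ℝ) • ⟨(2 + u.1) * X.1 * (2 - u.1), two_add_mul_mul_two_sub_mem u X⟩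

/-- The field at `x` is the image of `X` under left translation, so the chain rule at `1` applies to
chart ∘ translation, which in matrix terms is `A ↦ cay (a * A)` with `a = g⁻¹x`. -/
theorem mfderiv_chartO_leftInvariant (g x : O n) (hx : x ∈ (chartO g).source) (X : 𝔬 n) :
    mfderiv (I n) 𝓘(ℝ, E n) (chartO g) x (leftInvariant X x) = cayleyField X (chartO g x) := by
  have hx' := (mem_chartO_source g x).1 hx
  set a := incl n g⁻¹ * incl n x with ha
  let Φ : Mat n → E n := fun A => proj n (cay (a * A))
  have hF : (chartO g : O n → E n) ∘ (fun z : O n => x * z) = Φ ∘ incl n := by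
    funext z
    change chartO g (x * z) = proj n (cay (a * incl n z))
    rw [ha, mul_assoc, ← incl_mul, ← chartO_apply, proj_coe]
  have hc : HasFDerivAt (cay (n := n)) (fderiv ℝ (cay (n := n)) a) (a * 1) := by
    rw [mul_one]
    exact ((contDiffAt_cay hx' 1).differentiableAt (by simp)).hasFDerivAt
  have hΦ : HasFDerivAt Φ ((proj n).comp ((fderiv ℝ (cay (n := n)) a).comp
      (a • ContinuousLinearMap.id ℝ (Mat n)))) (incl n 1) :=
    (proj n).hasFDerivAt.comp _ (hc.comp (1 : Mat n) ((hasFDerivAt_id (1 : Mat n)).const_mul a))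
  have hincl : MDifferentiableAt (I n) 𝓘(ℝ, Mat n) (incl n) 1 :=
    (contMDiff_incl n 1 1).mdifferentiableAt (by simp)
  have hch : ∀ y, y = x → MDifferentiableAt (I n) 𝓘(ℝ, E n) (chartO g) y := by
    rintro _ rfl
    exact mdifferentiableAt_extChartAt (I := I n) (x := g) hx
  have h1 := mfderiv_comp (I := I n) (I' := I n) (I'' := 𝓘(ℝ, E n)) (1 : O n)
    (hch _ (mul_one x)) (mdifferentiableAt_mul_left x 1)
  rw [hF, mfderiv_comp (I := I n) (I' := 𝓘(ℝ, Mat n)) (1 : O n)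
    hΦ.hasMFDerivAt.mdifferentiableAt hincl, hΦ.hasMFDerivAt.mfderiv] at h1
  have h2 : ∀ y : O n, y = x * 1 → (show E n from mfderiv (I n) 𝓘(ℝ, E n) (chartO g) y
      (show E n from mfderiv (I n) (I n) (fun z : O n => x * z) 1 (show E n from X))) =
        proj n (fderiv ℝ (cay (n := n)) a (a * X.1)) := by
    rintro _ rfl
    have h3 := DFunLike.congr_fun h1 (show E n from X)
    refine h3.symm.trans ?_
    exact congrArg (fun A : Mat n => proj n (fderiv ℝ (cay (n := n)) a (a * A)))
      (mfderiv_incl_one n (show E n from X))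
  refine (h2 x (mul_one x).symm).trans ?_
  rw [fderiv_cay_mul hx', ← proj_coe (cayleyField X (chartO g x))]
  rfl

theorem chartO_self (g : O n) : chartO g g = 0 := by
  apply Subtype.ext
  rw [chartO_apply, incl_inv_mul, cay, sub_self, zero_mul, smul_zero]
  rfl

theorem fderiv_cayleyField_zero (X Y : 𝔬 n) :
    fderiv ℝ (cayleyField X) 0 Y = (1 / 2 : ℝ) • ⁅Y, X⁆ := by
  have hc : cayleyField X = fun u : E n =>
      proj n ((1 / 4 : ℝ) • (((2 : Mat n) + u.1) * X.1 * (2 - u.1))) :=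
    funext fun u => (proj_coe (cayleyField X u)).symm
  have hs : HasFDerivAt (fun u : E n => (u : Mat n)) (𝔬 n).toSubmodule.subtypeL 0 :=
    (𝔬 n).toSubmodule.subtypeL.hasFDerivAt
  have h := (proj n).hasFDerivAt.comp (0 : E n)
    ((((hs.const_add (2 : Mat n)).mul_const' X.1).mul' (hs.const_sub (2 : Mat n))).const_smul
      (1 / 4 : ℝ))
  rw [hc]
  refine (DFunLike.congr_fun h.fderiv Y).trans ?_
  change proj n ((1 / 4 : ℝ) • (((2 + (0 : Mat n)) * X.1) * (-Y.1) +
    (Y.1 * X.1) * (2 - (0 : Mat n)))) = _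
  rw [← proj_coe ((1 / 2 : ℝ) • ⁅Y, X⁆)]
  congr 1
  change _ = (1 / 2 : ℝ) • (Y.1 * X.1 - X.1 * Y.1)
  rw [add_zero, sub_zero, mul_two, mul_assoc, two_mul, mul_neg]
  module

theorem mpullbackWithin_leftInvariant (X : 𝔬 n) (g : O n) {u : E n}
    (hu : u ∈ (chartO g).target) :
    VectorField.mpullbackWithin 𝓘(ℝ, E n) (I n) (extChartAt (I n) g).symm (leftInvariant X)
      (Set.range (I n)) u = cayleyField X u := by
  have hu' : u ∈ (extChartAt (I n) g).target := by
    rw [extChartAt_target]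
    exact ⟨hu, Set.mem_range_self (f := I n) u⟩
  have h := mfderiv_chartO_leftInvariant g ((chartO g).symm u) ((chartO g).map_target hu) X
  rw [(chartO g).right_inv hu] at h
  rw [VectorField.mpullbackWithin_apply]
  refine (isInvertible_mfderivWithin_extChartAt_symm hu').inverse_apply_eq.2 ?_
  rw [← h]
  exact (DFunLike.congr_fun (mfderivWithin_extChartAt_symm_comp_mfderiv_extChartAt hu')
    (leftInvariant X ((chartO g).symm u))).symm

/-- At the chart origin the field of `X` has value `X` and derivative `½[Y,X]` along `Y`, so the
bracket there is `½[X,Y] - ½[Y,X] = [X,Y]`. Left invariance of the bracket carries this to every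
point. -/
theorem mlieBracket_leftInvariant (X Y : 𝔬 n) :
    VectorField.mlieBracket (I n) (leftInvariant X) (leftInvariant Y) = leftInvariant ⁅X, Y⁆ := by
  have h1 : VectorField.mlieBracket (I n) (leftInvariant X) (leftInvariant Y) (1 : O n) =
      (show E n from ⁅X, Y⁆) := by
    have h0 : (0 : E n) ∈ (chartO (1 : O n)).target := by
      rw [← chartO_self (1 : O n)]
      exact (chartO (1 : O n)).map_source (mem_chart_source (E n) (1 : O n))
    have hev (Z : 𝔬 n) : VectorField.mpullbackWithin 𝓘(ℝ, E n) (I n)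
        (extChartAt (I n) (1 : O n)).symm (leftInvariant Z) (Set.range (I n)) =ᶠ[nhds (0 : E n)]
          cayleyField Z := by
      filter_upwards [(chartO (1 : O n)).open_target.mem_nhds h0] with u hu
      exact mpullbackWithin_leftInvariant Z 1 hu
    have hz (Z : 𝔬 n) : cayleyField Z 0 = Z := by
      apply Subtype.ext
      change (1 / 4 : ℝ) • ((2 + (0 : Mat n)) * Z.1 * (2 - (0 : Mat n))) = Z.1
      rw [add_zero, sub_zero, mul_two, two_mul]
      module
    -- Tangent vectors at `1` are by definition their coordinates in the chart at `1`, so the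
    -- derivative of this chart there is the identity.
    have hinv (v : E n) : (mfderiv (I n) 𝓘(ℝ, E n) (extChartAt (I n) (1 : O n)) 1).inverse v = v :=
      (isInvertible_mfderiv_extChartAt (mem_extChartAt_source (1 : O n))).inverse_apply_eq.2
        (DFunLike.congr_fun (mfderiv_extChartAt_self (I := I n) (x := (1 : O n))) v).symm
    have hlie {V W : E n → E n} (hV : V =ᶠ[nhds (0 : E n)] cayleyField X)
        (hW : W =ᶠ[nhds (0 : E n)] cayleyField Y) {p : E n} (hp : p = 0) :
        VectorField.lieBracketWithin ℝ V W Set.univ p = (show E n from ⁅X, Y⁆) := by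
      rw [hp, VectorField.lieBracketWithin_univ, hV.lieBracket_vectorField_eq hW, VectorField.lieBracket, hz, hz]
      refine (congrArg₂ (fun a b : 𝔬 n => a - b) (fderiv_cayleyField_zero Y X)
        (fderiv_cayleyField_zero X Y)).trans ?_
      change (1 / 2 : ℝ) • ⁅X, Y⁆ - (1 / 2 : ℝ) • ⁅Y, X⁆ = ⁅X, Y⁆
      rw [← lie_skew X Y]
      module
    rw [← VectorField.mlieBracketWithin_univ, VectorField.mlieBracketWithin_apply]
    refine (hinv _).trans ?_
    rw [Set.preimage_univ, Set.univ_inter, ModelWithCorners.range_eq_univ]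
    rw [ModelWithCorners.range_eq_univ] at hev
    exact hlie (hev X) (hev Y) (chartO_self 1)
  rw [leftInvariant, leftInvariant, ← mulInvariantVector_mlieBracket]
  exact congrArg mulInvariantVectorField h1

/-! ### From the Levi-Civita connection to the algebraic formulas -/

variable {nabla : CovariantDerivative (I n) (E n) (TangentSpace (I n) : O n → Type)}

theorem covariantDerivative_leftInvariant (hn : 2 ≤ n)
    (hnabla : Riemannian.IsLeviCivita (gTilde n) nabla) (X Y : 𝔬 n) (x : O n) :
    nabla (leftInvariant Y) x (leftInvariant X x) = leftInvariant (leviCivitaProduct X Y) x := by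
  apply toLie_injective x
  rw [toLie_leftInvariant]
  refine eq_leviCivitaProduct
    (D := fun X Y => toLie x (nabla (leftInvariant Y) x (leftInvariant X x))) ?_ ?_ X Y
  · intro X Y
    have := nabla.torsion_eq_zero_iff.1 hnabla.torsion_eq_zero
      (mdifferentiableAt_leftInvariant X x) (mdifferentiableAt_leftInvariant Y x)
    rw [← map_sub, this, mlieBracket_leftInvariant, toLie_leftInvariant]
  · intro X Y Z
    have := hnabla.metric (leftInvariant Y) (leftInvariant Z) x (leftInvariant X x)
      (mdifferentiableAt_leftInvariant Y x) (mdifferentiableAt_leftInvariant Z x)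
    simp only [gTilde_leftInvariant hn] at this
    rw [gTilde_apply hn, gTilde_apply hn, toLie_leftInvariant, toLie_leftInvariant] at this
    rw [← this]
    -- The inner product of two left-invariant fields is constant, so its derivative vanishes; this
    -- is the skewness that the Koszul argument needs.
    simp [mvfderiv, mfderiv_const]

/-- Covariant derivatives of left-invariant fields along left-invariant fields are again
left-invariant, so the algebraic formula can be applied twice. -/
theorem toLie_curvature (hn : 2 ≤ n)
    (hnabla : Riemannian.IsLeviCivita (gTilde n) nabla) (X Y Z : 𝔬 n) (x : O n) :
    toLie x (Riemannian.curvature nabla (leftInvariant X) (leftInvariant Y) (leftInvariant Z) x) =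
      leviCivitaProduct X (leviCivitaProduct Y Z) - leviCivitaProduct Y (leviCivitaProduct X Z)
        - leviCivitaProduct ⁅X, Y⁆ Z := by
  have hc (X Y : 𝔬 n) : (fun y => nabla (leftInvariant Y) y (leftInvariant X y)) =
      leftInvariant (leviCivitaProduct X Y) :=
    funext (covariantDerivative_leftInvariant hn hnabla X Y)
  rw [Riemannian.curvature, hc, hc, mlieBracket_leftInvariant]
  simp only [covariantDerivative_leftInvariant hn hnabla]
  rw [map_sub, map_sub]
  simp only [toLie_leftInvariant]

theorem sectionalCurvature_leftInvariant (hn : 2 ≤ n)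
    (hnabla : Riemannian.IsLeviCivita (gTilde n) nabla) {X Y : 𝔬 n} {a b : ℝ}
    (hX : θ n X = a • X) (hY : θ n Y = b • Y) (hXX : halfTrace n X X = 1)
    (hYY : halfTrace n Y Y = 1) (hXY : halfTrace n X Y = 0) (x : O n) :
    Riemannian.sectionalCurvature (gTilde n) nabla (leftInvariant X) (leftInvariant Y) x =
      b * ((1 + a * b - b) / 2 - (1 + a - b) * (1 + b - a * b) / 4) *
        halfTrace n ⁅X, Y⁆ ⁅X, Y⁆ := by
  rw [← halfTrace_curvature hX hY, Riemannian.sectionalCurvature]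
  simp only [gTilde_leftInvariant hn, hXX, hYY, hXY]
  rw [gTilde_apply hn, toLie_curvature hn hnabla, toLie_leftInvariant,
    show (1 : ℝ) * 1 - 0 ^ 2 = 1 by norm_num, div_one]

end Lorentz

end

/-! ### The curvature bounds -/

theorem mainTheorem9 (n : ℕ) (hn : 2 ≤ n)
    (nabla : CovariantDerivative (Lorentz.I n) (Lorentz.E n)
      (TangentSpace (Lorentz.I n) : Lorentz.O n → Type))
    (hnabla : Riemannian.IsLeviCivita (Lorentz.gTilde n) nabla) (x : Lorentz.O n) :
    (∀ X ∈ Lorentz.standardBasis n, ∀ Y ∈ Lorentz.standardBasis n, X ≠ Y →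
      Riemannian.sectionalCurvature (Lorentz.gTilde n) nabla
        (Lorentz.leftInvariant X) (Lorentz.leftInvariant Y) x ≤ 1 / 4) ∧
    (∀ i j : Fin n, i ≠ j →
      Riemannian.sectionalCurvature (Lorentz.gTilde n) nabla
        (Lorentz.leftInvariant (Lorentz.σ i)) (Lorentz.leftInvariant (Lorentz.σ j)) x ≤ 0) := by
  open Lorentz in
  have hα {i j : Fin n} (h : i < j) : halfTrace n (α i j) (α i j) = 1 := by
    simp [halfTrace_α_α, h.ne]
  have hσ (i : Fin n) : halfTrace n (σ i) (σ i) = 1 := by simp [halfTrace_σ_σ]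
  have hσσ (i j : Fin n) (h : i ≠ j) : Riemannian.sectionalCurvature (gTilde n) nabla
      (leftInvariant (σ i)) (leftInvariant (σ j)) x ≤ 0 := by
    rw [sectionalCurvature_leftInvariant hn hnabla (θ_σ i) (θ_σ j) (hσ i) (hσ j)
      (by simp [halfTrace_σ_σ, h]), bracket_σ_σ, halfTrace_α_α]
    -- Here `a = b = -1` and `‖[σ_i,σ_j]‖² = ‖α_ij‖² = 1`, so the curvature equals `-7/4`.
    simp [h]
    norm_num
  refine ⟨?_, hσσ⟩
  rintro X (⟨i, j, hij, rfl⟩ | ⟨i, rfl⟩) Y (⟨k, l, hkl, rfl⟩ | ⟨k, rfl⟩) hXY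
  · have h : ¬(i = k ∧ j = l) := by
      rintro ⟨rfl, rfl⟩
      exact hXY rfl
    have h' : ¬(i = l ∧ j = k) := by
      rintro ⟨rfl, rfl⟩
      exact lt_asymm hij hkl
    rw [sectionalCurvature_leftInvariant hn hnabla (θ_α i j) (θ_α k l) (hα hij) (hα hkl)
      (by simp [halfTrace_α_α, h, h'])]
    -- The coefficient at `a = b = 1` is `1/4`; the two mixed cases below have the same coefficient.
    linarith [halfTrace_bracket_α_α_le hij hkl h]
  · rw [sectionalCurvature_leftInvariant hn hnabla (θ_α i j) (θ_σ k) (hα hij) (hσ k)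
      (halfTrace_α_σ i j k)]
    linarith [halfTrace_bracket_α_σ_le i j k hij.ne]
  · have h : halfTrace n ⁅σ i, α k l⁆ ⁅σ i, α k l⁆ ≤ 1 := by
      rw [← lie_skew]
      simp only [map_neg, LinearMap.neg_apply, neg_neg]
      exact halfTrace_bracket_α_σ_le k l i hkl.ne
    rw [sectionalCurvature_leftInvariant hn hnabla (θ_σ i) (θ_α k l) (hσ i) (hα hkl)
      (by rw [halfTrace_comm, halfTrace_α_σ])]
    linarith
  · have h : i ≠ k := by
      rintro rfl
      exact hXY rfl
    linarith [hσσ i k h]
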